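/- Let $A$ be a totally ordered alphabet. The Baxter congruence $\equiv_B$ is the congruence on the free monoid $A^*$ generated by $$c\,u\,ad\,v\,b \equiv c\,u\,da\,v\,b \quad (a \le b < c \le d), \qquad b\,u\,da\,v\,c \equiv b\,u\,ad\,v\,c \quad (a < b \le c < d),$$ for letters $a,b,c,d$ and words $u,v$. A permutation $\sigma$ of size $n$ is regarded as the word $\sigma_1\cdots\sigma_n$ on the alphabet $\{1,\dots,n\}$. It is a Baxter permutation if it avoids $2\text{-}41\text{-}3$ and $3\text{-}14\text{-}2$, i.e. if no subword $\sigma_i\sigma_j\sigma_{j+1}\sigma_l$ with $i<j$, $j+1<l$ is ordered as $2413$ or as $3142$. A binary tree is either a leaf (the empty tree) or a node with a left and a right subtree. The canopy of a binary tree is the word on $\{0,1\}$ obtained by reading its leaves from left to right, except the first and the last one, writing $0$ for a leaf that is a right child and $1$ for a leaf that is a left child. A pair $(T_L,T_R)$ of binary trees with $n$ nodes each is a pair of twin binary trees if their canopies differ at every position $1\le i\le n-1$. A tree with nodes labeled in $A$ is a left (resp. right) binary search tree if $a<b\le c$ (resp. $a\le b<c$) for each node labeled $b$ and all labels $a$ in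 its left and $c$ in its right subtree. A pair of twin binary search trees is a pair of twin binary trees labeled in $A$ such that $T_L$ is a left and $T_R$ a right binary search tree and both have the same inorder reading. The P-symbol of a word $u$ is the pair $(T_L,T_R)$ where $T_L$ (resp. $T_R$) is obtained from the empty tree by inserting the letters of $u$ from left to right (resp. from right to left) as new leaves of a left (resp. right) binary search tree: a letter $a$ goes to the left subtree of a node labeled $b$ if $a<b$ (resp. $a\le b$), and to the right subtree otherwise. **Theorem.** For every $n\ge 0$: 1. Each equivalence class of permutations of size $n$ under $\equiv_B$ contains exactly one Baxter permutation. 2. Mapping a permutation to the shape (the pair of underlying unlabeled trees) of its P-symbol induces a bijection from the set of $\equiv_B$-equivalence classes of permutations of size $n$ onto the set of unlabeled pairs of twin binary trees with $n$ nodes. 3. Mapping a word to its P-symbol induces a bijection from the set of $\equiv_B$-equivalence classes of words of length $n$ over $A$ onto the set of pairs of twin binary search trees labeled in $A$ with $n$ nodes. -/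

import Mathlib

/-! The Baxter monoid, Baxter permutations and pairs of twin binary trees. Words on the alphabet `α`
are lists `List α`; binary trees are Mathlib's `BinaryTree`, so that `BinaryTree α` is the type of
binary trees whose (internal) nodes are labeled by `α`, the leaf is `BinaryTree.nil`, and
`BinaryTree Unit` is the type of unlabeled binary trees. -/

namespace Baxter

section Monoid

variable {α : Type*} [LinearOrder α]

/-- The two Baxter adjacency relations:
`c u ad v b ⇋ c u da v b` for `a ≤ b < c ≤ d`, and
`b u da v c ⇌ b u ad v c` for `a < b ≤ c < d`. -/
inductive Adj : FreeMonoid α → FreeMonoid α → Prop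
  | left (u v : List α) (a b c d : α) (hab : a ≤ b) (hbc : b < c) (hcd : c ≤ d) :
      Adj (FreeMonoid.ofList ([c] ++ u ++ [a, d] ++ v ++ [b]))
        (FreeMonoid.ofList ([c] ++ u ++ [d, a] ++ v ++ [b]))
  | right (u v : List α) (a b c d : α) (hab : a < b) (hbc : b ≤ c) (hcd : c < d) :
      Adj (FreeMonoid.ofList ([b] ++ u ++ [d, a] ++ v ++ [c]))
        (FreeMonoid.ofList ([b] ++ u ++ [a, d] ++ v ++ [c]))

variable (α) in
/-- The Baxter congruence on the free monoid: the congruence generated by the adjacency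
relations. The Baxter monoid is its quotient. -/
def congruence : Con (FreeMonoid α) := conGen Adj

/-- Baxter equivalence of words. -/
def Equivalent (u v : List α) : Prop :=
  congruence α (FreeMonoid.ofList u) (FreeMonoid.ofList v)

/-- Words of length `n`. -/
abbrev Word (α : Type*) (n : ℕ) : Type _ := {u : List α // u.length = n}

variable (α) in
/-- Baxter equivalence on the words of length `n`. -/
def wordSetoid (n : ℕ) : Setoid (Word α n) where
  r u v := Equivalent u.1 v.1
  iseqv :=
    ⟨fun _ => (congruence α).refl _, fun h => (congruence α).symm h,
      fun h k => (congruence α).trans h k⟩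

end Monoid

section Permutations

/-- A permutation `σ` of size `n` seen as the word `σ(0) σ(1) … σ(n-1)`. -/
def permWord {n : ℕ} (σ : Equiv.Perm (Fin n)) : List (Fin n) := List.ofFn σ

/-- Baxter equivalence on the permutations of size `n`. -/
def permSetoid (n : ℕ) : Setoid (Equiv.Perm (Fin n)) where
  r σ τ := Equivalent (permWord σ) (permWord τ)
  iseqv :=
    ⟨fun _ => (congruence (Fin n)).refl _, fun h => (congruence (Fin n)).symm h,
      fun h k => (congruence (Fin n)).trans h k⟩

/-- Baxter permutations: those that avoid the generalized patterns `2-41-3` and `3-14-2`, where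
the letters at the positions `j` and `k` have to be adjacent. -/
def IsBaxter {n : ℕ} (σ : Equiv.Perm (Fin n)) : Prop :=
  ∀ i j k l : Fin n, i < j → (k : ℕ) = (j : ℕ) + 1 → k < l →
    ¬ (σ k < σ i ∧ σ i < σ l ∧ σ l < σ j) ∧ ¬ (σ j < σ l ∧ σ l < σ i ∧ σ i < σ k)

end Permutations

section Trees

variable {α : Type*}

/-- The labels of the nodes, listed by the inorder traversal. -/
def inorder : BinaryTree α → List α
  | .nil => []
  | .node a l r => inorder l ++ a :: inorder r

/-- The shape of a labeled binary tree, obtained by forgetting the labels. -/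
def shape (T : BinaryTree α) : BinaryTree Unit := T.map fun _ => ()

/-- The orientations of the leaves from left to right: `true` (the letter `1`) for a
left-oriented leaf, `false` (the letter `0`) for a right-oriented leaf. The first argument is the
orientation of the edge above the tree. -/
def leafOrientations : Bool → BinaryTree α → List Bool
  | o, .nil => [o]
  | _, .node _ l r => leafOrientations true l ++ leafOrientations false r

/-- The canopy: the orientations of all leaves but the first and the last one. (The orientation
given to the edge above the root plays no role, since a leaf that is the whole tree is dropped.) -/
def canopy (T : BinaryTree α) : List Bool := (leafOrientations true T).tail.dropLast

/-- `J = (T_L, T_R)` is a pair of twin binary trees with `n` nodes each: the canopies, which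
have length `n - 1`, are complementary. -/
def IsTwin (n : ℕ) (J : BinaryTree α × BinaryTree α) : Prop :=
  J.1.numNodes = n ∧ J.2.numNodes = n ∧
    List.Forall₂ (fun x y => x ≠ y) (canopy J.1) (canopy J.2)

/-- The set of unlabeled pairs of twin binary trees with `n` nodes. -/
def twinTrees (n : ℕ) : Set (BinaryTree Unit × BinaryTree Unit) := {J | IsTwin n J}

variable [LinearOrder α]

/-- Left binary search trees: `a < b ≤ c` for each node labeled `b` and all labels `a` in its left
and `c` in its right subtree. -/
def IsLeftBST : BinaryTree α → Prop
  | .nil => True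
  | .node b l r => (∀ a ∈ inorder l, a < b) ∧ (∀ c ∈ inorder r, b ≤ c) ∧ IsLeftBST l ∧ IsLeftBST r

/-- Right binary search trees: `a ≤ b < c` for each node labeled `b` and all labels `a` in its left
and `c` in its right subtree. -/
def IsRightBST : BinaryTree α → Prop
  | .nil => True
  | .node b l r =>
      (∀ a ∈ inorder l, a ≤ b) ∧ (∀ c ∈ inorder r, b < c) ∧ IsRightBST l ∧ IsRightBST r

variable (α) in
/-- The set of pairs of twin binary search trees with `n` nodes labeled by `α`: a left and a right
binary search tree that form a pair of twin binary trees and have the same inorder reading. -/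
def twinSearchTrees (n : ℕ) : Set (BinaryTree α × BinaryTree α) :=
  {J | IsTwin n J ∧ IsLeftBST J.1 ∧ IsRightBST J.2 ∧ inorder J.1 = inorder J.2}

/-- Leaf insertion of `a` into a left binary search tree. -/
def leftInsert (a : α) : BinaryTree α → BinaryTree α
  | .nil => .node a .nil .nil
  | .node b l r => if a < b then .node b (leftInsert a l) r else .node b l (leftInsert a r)

/-- Leaf insertion of `a` into a right binary search tree. -/
def rightInsert (a : α) : BinaryTree α → BinaryTree α
  | .nil => .node a .nil .nil
  | .node b l r => if a ≤ b then .node b (rightInsert a l) r else .node b l (rightInsert a r)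

/-- The Baxter P-symbol `(T_L, T_R)` of a word: `T_L` (resp. `T_R`) is obtained by leaf inserting
the letters from left to right (resp. from right to left). -/
def pSymbol (u : List α) : BinaryTree α × BinaryTree α :=
  (u.foldl (fun T a => leftInsert a T) .nil, u.foldr rightInsert .nil)

end Trees

end Baxter

/-! The proof is an induction on the length that deletes the last occurrence of the largest letter
`m`. In a word `u m v` cut there, `m` is the last node in inorder of both trees. The trees of `u m
v` arise from those of `u v` by cutting the right branch below `leftDepth u`, resp. `rightDepth v`,
nodes and putting `m` there (`pSymbol_append_cons`). So the P-symbol of `u m v` carries the same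
data as `m`, the P-symbol of `u v` and two depths.

Both Baxter relations are cases of one exchange, `Swap`: the letters `c` and `b` send `a` and `d` to
different sides in the left and in the right tree, so the P-symbol is invariant. Conversely, words
with equal P-symbols have equivalent remainders by induction. Insertion of `m` lifts along this
equivalence (`Swap.insertMaxLift`), which leaves two positions of `m` in the same word. Equality of
the depths says that each letter between the positions has a larger letter before them and one at
least as large after them, and this is what lets `m` pass (`equivalent_move_max`).

As for the image, inserting `m` appends to each canopy a letter telling whether the depth is full.
The left depth is full iff the last maximum of `u v` lies in `u`, the right one iff it lies in `v`;
hence the canopies are complementary. Conversely, if exactly one depth is full, a record of the word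
shows where to insert `m` (`exists_pSymbol_eq_cutInsert`).

In a Baxter word, among the positions of a new maximum with given depths, exactly one creates no
forbidden pattern. For permutations the inorder reading is always the same, so shapes lose nothing.
-/

namespace Baxter

/-! ### Splitting lists -/

section Lists

variable {α : Type*}

/-- The cut falls after, inside or before the adjacent pair. It marks the place of an inserted or
deleted maximal letter. -/
theorem append_eq_append_cons_cons {u v p q : List α} {x y : α}
    (h : u ++ v = p ++ x :: y :: q) :
    (∃ e, u = p ++ x :: y :: e ∧ q = e ++ v) ∨ (u = p ++ [x] ∧ v = y :: q) ∨
      ∃ e, p = u ++ e ∧ v = e ++ x :: y :: q := by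
  rcases List.append_eq_append_iff.1 h with ⟨e, rfl, rfl⟩ | ⟨e, rfl, h⟩
  · exact Or.inr (Or.inr ⟨e, rfl, rfl⟩)
  · rcases e with _ | ⟨z, _ | ⟨z', e⟩⟩
    · exact Or.inr (Or.inr ⟨[], by simp, by simpa [eq_comm] using h⟩)
    · simp at h; simp [h]
    · simp at h; simp [h]

theorem exists_first_split {P : α → Prop} {v : List α} (h : ∃ x ∈ v, P x) :
    ∃ s x t, v = s ++ x :: t ∧ P x ∧ ∀ y ∈ s, ¬ P y := by
  induction v with
  | nil => simp at h
  | cons a v ih =>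
    by_cases ha : P a
    · exact ⟨[], a, v, rfl, ha, by simp⟩
    · obtain ⟨s, x, t, rfl, hx, hs⟩ := ih (by simpa [ha] using h)
      exact ⟨a :: s, x, t, rfl, hx, by simpa [ha] using hs⟩

end Lists

/-! ### Leaf insertion and the right branch -/

section TreeInsertion

variable {α : Type*}

/-- Leaf insertion of `a`, going left at a node labeled `b` if and only if `r a b`. -/
def leafInsert (r : α → α → Prop) [DecidableRel r] (a : α) : BinaryTree α → BinaryTree α
  | .nil => .node a .nil .nil
  | .node b s t => if r a b then .node b (leafInsert r a s) t else .node b s (leafInsert r a t)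

/-- The tree obtained by leaf inserting the letters of a word from left to right. -/
def searchTree (r : α → α → Prop) [DecidableRel r] (u : List α) : BinaryTree α :=
  u.foldl (fun T a => leafInsert r a T) .nil

/-- The labels on the right branch of a tree, from the root downwards. -/
def rightBranch : BinaryTree α → List α
  | .nil => []
  | .node b _ t => b :: rightBranch t

/-- Insert `a` as the last node in inorder, below the first `k` nodes of the right branch; the
rest of the tree becomes the left subtree of `a`. -/
def cutInsert (a : α) : ℕ → BinaryTree α → BinaryTree α
  | 0, T => .node a T .nil
  -- Default value outside the meaningful range `k ≤ (rightBranch T).length`; it keeps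
  -- `inorder_cutInsert` true for every `k`.
  | _ + 1, .nil => .node a .nil .nil
  | k + 1, .node b s t => .node b s (cutInsert a k t)

/-- Binary search trees in which `r a b` holds for the labels `a` to the left of a node labeled
`b`, and fails for those to the right. -/
def IsSearchTree (r : α → α → Prop) : BinaryTree α → Prop
  | .nil => True
  | .node b s t =>
      (∀ a ∈ inorder s, r a b) ∧ (∀ c ∈ inorder t, ¬ r c b) ∧ IsSearchTree r s ∧ IsSearchTree r t

theorem length_inorder (T : BinaryTree α) : (inorder T).length = T.numNodes := by
  induction T with
  | nil => rfl
  | node b s t ihs iht => simp [inorder, ihs, iht]; omega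

theorem rightBranch_subset_inorder (T : BinaryTree α) : rightBranch T ⊆ inorder T := by
  induction T with
  | nil => simp [rightBranch]
  | node b s t ihs iht =>
    simp only [rightBranch, inorder]
    intro x hx
    rcases List.mem_cons.1 hx with rfl | hx
    · simp
    · simp [iht hx]

theorem inorder_cutInsert (a : α) (k : ℕ) (T : BinaryTree α) :
    inorder (cutInsert a k T) = inorder T ++ [a] := by
  induction k generalizing T with
  | zero => simp [cutInsert, inorder]
  | succ k ih => cases T <;> simp [cutInsert, inorder, ih]

theorem length_rightBranch_cutInsert (a : α) {k : ℕ} {T : BinaryTree α}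
    (hk : k ≤ (rightBranch T).length) : (rightBranch (cutInsert a k T)).length = k + 1 := by
  induction k generalizing T with
  | zero => simp [cutInsert, rightBranch]
  | succ k ih =>
    cases T with
    | nil => simp [rightBranch] at hk
    | node b s t =>
      simp only [rightBranch, List.length_cons, add_le_add_iff_right] at hk
      simp [cutInsert, rightBranch, ih hk]

/-- The right branch of the result has `k + 1` nodes, which recovers `k`; the rest is read off along
that branch. -/
theorem cutInsert_injective {a a' : α} {k k' : ℕ} {T T' : BinaryTree α}
    (hk : k ≤ (rightBranch T).length) (hk' : k' ≤ (rightBranch T').length)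
    (h : cutInsert a k T = cutInsert a' k' T') : a = a' ∧ k = k' ∧ T = T' := by
  induction k generalizing T T' k' with
  | zero =>
    cases k' with
    | zero => simpa [cutInsert] using h
    | succ k' =>
      have := congrArg (fun T => (rightBranch T).length) h
      rw [length_rightBranch_cutInsert _ hk, length_rightBranch_cutInsert _ hk'] at this
      omega
  | succ k ih =>
    have := congrArg (fun T => (rightBranch T).length) h
    rw [length_rightBranch_cutInsert _ hk, length_rightBranch_cutInsert _ hk'] at this
    obtain rfl : k + 1 = k' := by omega
    cases T with
    | nil => simp [rightBranch] at hk
    | node b s t =>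
      cases T' with
      | nil => simp [rightBranch] at hk'
      | node b' s' t' =>
        simp only [rightBranch, List.length_cons, add_le_add_iff_right] at hk hk'
        simp only [cutInsert, BinaryTree.node.injEq] at h
        obtain ⟨rfl, -, rfl⟩ := ih hk hk' h.2.2
        simp [h.1, h.2.1]

/-- The end of the right branch is removed and its left subtree takes its place. -/
theorem exists_eq_cutInsert {T : BinaryTree α} (hT : T ≠ .nil) :
    ∃ a k T', k ≤ (rightBranch T').length ∧ T = cutInsert a k T' := by
  induction T with
  | nil => exact absurd rfl hT
  | node b s t _ iht =>
    cases t with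
    | nil => exact ⟨b, 0, s, Nat.zero_le _, rfl⟩
    | node c s' t' =>
      obtain ⟨a, k, T', hk, h⟩ := iht (by simp)
      exact ⟨a, k + 1, .node b s T', by simpa [rightBranch] using hk, by rw [h, cutInsert]⟩

theorem leafOrientations_ne_nil (o : Bool) (T : BinaryTree α) : leafOrientations o T ≠ [] := by
  induction T generalizing o with
  | nil => simp [leafOrientations]
  | node b s t ihs _ => simp [leafOrientations, ihs]

theorem leafOrientations_concat {T : BinaryTree α} (hT : T ≠ .nil) (o : Bool) :
    ∃ l, leafOrientations o T = l ++ [false] ∧ l ≠ [] := by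
  induction T generalizing o with
  | nil => exact absurd rfl hT
  | node b s t _ iht =>
    have hs : leafOrientations true s ≠ [] := leafOrientations_ne_nil _ _
    cases t with
    | nil => exact ⟨_, rfl, hs⟩
    | node c s' t' =>
      obtain ⟨l, h, -⟩ := iht (by simp) false
      exact ⟨leafOrientations true s ++ l, by rw [leafOrientations, h, List.append_assoc],
        by simp [hs]⟩

/-- The last leaf of `T` becomes the leaf just before the node `a`. If the cut is at the end of the
branch, this is the left child of `a`; otherwise it still ends the nonempty subtree moved below `a`,
hence remains a right child. -/
theorem leafOrientations_cutInsert (a : α) {k : ℕ} {T : BinaryTree α} (hT : T ≠ .nil)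
    (hk : k ≤ (rightBranch T).length) (o : Bool) :
    leafOrientations o (cutInsert a k T) =
      (leafOrientations o T).dropLast ++ [decide (k = (rightBranch T).length), false] := by
  induction k generalizing T o with
  | zero =>
    cases T with
    | nil => exact absurd rfl hT
    | node b s t =>
      obtain ⟨l, h, -⟩ := leafOrientations_concat (T := .node b s t) (by simp) true
      have h' : leafOrientations o (.node b s t) = l ++ [false] := h
      simp [cutInsert, leafOrientations.eq_2 _ a, h, h', rightBranch, leafOrientations.eq_1]
  | succ k ih =>
    cases T with
    | nil => exact absurd rfl hT
    | node b s t =>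
      simp only [rightBranch, List.length_cons, add_le_add_iff_right] at hk
      cases t with
      | nil =>
        obtain rfl : k = 0 := by simpa [rightBranch] using hk
        simp [cutInsert, leafOrientations, rightBranch]
      | node c s' t' =>
        obtain ⟨l, h, -⟩ := leafOrientations_concat (T := .node c s' t') (by simp) false
        rw [cutInsert, leafOrientations, ih (by simp) hk, leafOrientations.eq_2 _ b, h]
        simp only [rightBranch, List.length_cons, List.dropLast_concat, add_left_inj,
          ← List.append_assoc]
        congr

theorem canopy_cutInsert (a : α) {k : ℕ} {T : BinaryTree α} (hT : T ≠ .nil)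
    (hk : k ≤ (rightBranch T).length) :
    canopy (cutInsert a k T) = canopy T ++ [decide (k = (rightBranch T).length)] := by
  obtain ⟨l, h, hl⟩ := leafOrientations_concat hT true
  rw [canopy, canopy, leafOrientations_cutInsert a hT hk, h]
  obtain ⟨x, l, rfl⟩ := List.exists_cons_of_ne_nil hl
  rw [List.dropLast_concat]
  simp

theorem canopy_cutInsert_nil (a : α) (k : ℕ) : canopy (cutInsert a k .nil) = [] := by
  cases k <;> simp [canopy, cutInsert, leafOrientations]

variable {r : α → α → Prop}

theorem IsSearchTree.of_cutInsert {a : α} {k : ℕ} {T : BinaryTree α}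
    (h : IsSearchTree r (cutInsert a k T)) : IsSearchTree r T := by
  induction k generalizing T with
  | zero => exact h.2.2.1
  | succ k ih =>
    cases T with
    | nil => trivial
    | node b s t =>
      refine ⟨h.1, fun c hc => h.2.1 c ?_, h.2.2.1, ih h.2.2.2⟩
      rw [inorder_cutInsert]; simp [hc]

/-- A nonempty part of the right branch lies to the left of `a`; `hr` carries the relation from
there up to the nodes above the cut. For `<` this yields the strict maximality of `a`. -/
theorem IsSearchTree.rel_of_cutInsert_lt [IsTrans α r] (hr : ∀ a b c, r a c → ¬ r a b → r b c)
    {a : α} {k : ℕ} {T : BinaryTree α} (hk : k < (rightBranch T).length)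
    (h : IsSearchTree r (cutInsert a k T)) : ∀ x ∈ inorder T, r x a := by
  induction k generalizing T with
  | zero => exact h.1
  | succ k ih =>
    cases T with
    | nil => simp [rightBranch] at hk
    | node b s t =>
      simp only [rightBranch, List.length_cons, add_lt_add_iff_right] at hk
      have H := ih hk h.2.2.2
      have hb : r b a := by
        cases t with
        | nil => simp [rightBranch] at hk
        | node c s' t' =>
          refine hr c b a (H c (by simp [inorder])) (h.2.1 c ?_)
          rw [inorder_cutInsert]; simp [inorder]
      intro x hx
      simp only [inorder, List.mem_append, List.mem_cons] at hx
      rcases hx with hx | rfl | hx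
      · exact _root_.trans (h.1 x hx) hb
      · exact hb
      · exact H x hx

variable [DecidableRel r]

theorem inorder_leafInsert_perm (a : α) (T : BinaryTree α) :
    (inorder (leafInsert r a T)).Perm (a :: inorder T) := by
  induction T with
  | nil => simp [leafInsert, inorder]
  | node b s t ihs iht =>
    simp only [leafInsert]
    split_ifs
    · simpa [inorder] using ihs.append_right (b :: inorder t)
    · refine ((iht.cons b).append_left (inorder s)).trans ?_
      simp only [inorder]
      exact (((List.Perm.swap a b _).append_left _).trans List.perm_middle)

theorem IsSearchTree.leafInsert {T : BinaryTree α} (h : IsSearchTree r T) (a : α) :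
    IsSearchTree r (leafInsert r a T) := by
  induction T with
  | nil => simp [Baxter.leafInsert, IsSearchTree, inorder]
  | node b s t ihs iht =>
    obtain ⟨h1, h2, h3, h4⟩ := h
    simp only [Baxter.leafInsert]
    split_ifs with hab
    · refine ⟨fun x hx => ?_, h2, ihs h3, h4⟩
      rcases List.mem_cons.1 ((inorder_leafInsert_perm a s).mem_iff.1 hx) with rfl | hx
      exacts [hab, h1 x hx]
    · refine ⟨h1, fun x hx => ?_, h3, iht h4⟩
      rcases List.mem_cons.1 ((inorder_leafInsert_perm a t).mem_iff.1 hx) with rfl | hx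
      exacts [hab, h2 x hx]

theorem searchTree_concat (u : List α) (a : α) :
    searchTree r (u ++ [a]) = leafInsert r a (searchTree r u) := by
  simp [searchTree]

theorem inorder_searchTree_perm (u : List α) : (inorder (searchTree r u)).Perm u := by
  induction u using List.reverseRecOn with
  | nil => simp [searchTree, inorder]
  | append_singleton u a ih =>
    rw [searchTree_concat]
    exact (inorder_leafInsert_perm a _).trans
      ((ih.cons a).trans (List.perm_append_singleton a u).symm)

theorem isSearchTree_searchTree (u : List α) : IsSearchTree r (searchTree r u) := by
  induction u using List.reverseRecOn with
  | nil => trivial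
  | append_singleton u a ih => rw [searchTree_concat]; exact ih.leafInsert a

theorem searchTree_ne_nil {u : List α} (hu : u ≠ []) : searchTree r u ≠ .nil := by
  intro h
  have := (inorder_searchTree_perm (r := r) u).length_eq
  simp [h, inorder] at this
  exact hu (List.eq_nil_of_length_eq_zero this.symm)

theorem rightBranch_leafInsert (a : α) (T : BinaryTree α) :
    rightBranch (leafInsert r a T) =
      if ∃ b ∈ rightBranch T, r a b then rightBranch T else rightBranch T ++ [a] := by
  induction T with
  | nil => simp [leafInsert, rightBranch]
  | node b s t _ iht =>
    by_cases hab : r a b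
    · simp [leafInsert, rightBranch, hab]
    · simp only [leafInsert, rightBranch, hab, if_false, iht, List.exists_mem_cons_iff, false_or]
      split_ifs <;> simp

theorem leafInsert_cutInsert_last {a : α} {T : BinaryTree α}
    (h : ∀ b ∈ rightBranch T, ¬ r a b) :
    leafInsert r a T = cutInsert a (rightBranch T).length T := by
  induction T with
  | nil => rfl
  | node b s t _ iht =>
    simp only [rightBranch, List.forall_mem_cons] at h
    simp [leafInsert, rightBranch, cutInsert, h.1, iht h.2]

/-- The letter `x` goes left at `a` and then continues as if `a` were absent. -/
theorem leafInsert_cutInsert {a x : α} (hxa : r x a) {k : ℕ} {T : BinaryTree α}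
    (hk : k ≤ (rightBranch T).length) :
    leafInsert r x (cutInsert a k T) = cutInsert a k (leafInsert r x T) := by
  induction k generalizing T with
  | zero => simp [cutInsert, leafInsert, hxa]
  | succ k ih =>
    cases T with
    | nil => simp [rightBranch] at hk
    | node b s t =>
      simp only [rightBranch, List.length_cons, add_le_add_iff_right] at hk
      by_cases hxb : r x b <;> simp [cutInsert, leafInsert, hxb, ih hk]

theorem rightBranch_searchTree_subset (u : List α) : rightBranch (searchTree r u) ⊆ u :=
  fun _ hx => (inorder_searchTree_perm u).mem_iff.1 (rightBranch_subset_inorder _ hx)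

theorem rightBranch_prefix_append (u s : List α) :
    rightBranch (searchTree r u) <+: rightBranch (searchTree r (u ++ s)) := by
  induction s using List.reverseRecOn with
  | nil => simp
  | append_singleton s a ih =>
    rw [← List.append_assoc, searchTree_concat, rightBranch_leafInsert]
    split_ifs
    · exact ih
    · exact ih.trans (List.prefix_append _ _)

theorem length_rightBranch_le_append (u s : List α) :
    (rightBranch (searchTree r u)).length ≤ (rightBranch (searchTree r (u ++ s))).length :=
  (rightBranch_prefix_append u s).length_le

theorem searchTree_append_cons {u v : List α} {a : α} (hu : ∀ x ∈ u, ¬ r a x)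
    (hv : ∀ x ∈ v, r x a) :
    searchTree r (u ++ a :: v) =
      cutInsert a (rightBranch (searchTree r u)).length (searchTree r (u ++ v)) := by
  induction v using List.reverseRecOn with
  | nil =>
    rw [searchTree_concat, List.append_nil]
    exact leafInsert_cutInsert_last fun b hb => hu b (rightBranch_searchTree_subset u hb)
  | append_singleton v x ih =>
    rw [← List.cons_append, ← List.append_assoc, searchTree_concat, ← List.append_assoc,
      searchTree_concat, ih fun y hy => hv y (by simp [hy]),
      leafInsert_cutInsert (hv x (by simp)) (length_rightBranch_le_append u v)]

/-- The right branch consists of the records of the word, and each letter is dominated by a record.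
-/
theorem mem_rightBranch_or_exists_rel {u : List α} {x : α} (hx : x ∈ u) :
    x ∈ rightBranch (searchTree r u) ∨ ∃ b ∈ rightBranch (searchTree r u), r x b := by
  induction u using List.reverseRecOn with
  | nil => simp at hx
  | append_singleton u a ih =>
    have sub := (rightBranch_prefix_append (r := r) u [a]).subset
    rcases List.mem_append.1 hx with hx | hx
    · exact (ih hx).imp (fun h => sub h) fun ⟨b, hb, h⟩ => ⟨b, sub hb, h⟩
    · obtain rfl := List.mem_singleton.1 hx
      rw [searchTree_concat, rightBranch_leafInsert]
      split_ifs with h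
      · exact Or.inr h
      · simp

variable [IsTrans α r]

theorem exists_rightBranch_rel_iff {u : List α} {x : α} :
    (∃ b ∈ rightBranch (searchTree r u), r x b) ↔ ∃ b ∈ u, r x b := by
  refine ⟨fun ⟨b, hb, h⟩ => ⟨b, rightBranch_searchTree_subset u hb, h⟩, fun ⟨b, hb, h⟩ => ?_⟩
  rcases mem_rightBranch_or_exists_rel (r := r) hb with hb | ⟨c, hc, hbc⟩
  exacts [⟨b, hb, h⟩, ⟨c, hc, _root_.trans h hbc⟩]

theorem rightBranch_searchTree_concat (u : List α) (x : α) :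
    rightBranch (searchTree r (u ++ [x])) =
      if ∃ b ∈ u, r x b then rightBranch (searchTree r u)
      else rightBranch (searchTree r u) ++ [x] := by
  rw [searchTree_concat, rightBranch_leafInsert]
  simp only [exists_rightBranch_rel_iff]

theorem length_rightBranch_append_eq_iff {u s : List α} :
    (rightBranch (searchTree r u)).length = (rightBranch (searchTree r (u ++ s))).length ↔
      ∀ x ∈ s, ∃ y ∈ u, r x y := by
  induction s using List.reverseRecOn with
  | nil => simp
  | append_singleton s x ih =>
    have hle := length_rightBranch_le_append (r := r) u s
    rw [← List.append_assoc, rightBranch_searchTree_concat]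
    constructor
    · intro h
      split_ifs at h with hx
      · have hs := ih.1 h
        obtain ⟨b, hb, hxb⟩ := hx
        intro y hy
        rcases List.mem_append.1 hy with hy | hy
        · exact hs y hy
        · obtain rfl := List.mem_singleton.1 hy
          rcases List.mem_append.1 hb with hb | hb
          · exact ⟨b, hb, hxb⟩
          -- The dominating letter may itself lie in `s`; it is then replaced by a letter of `u`
          -- that dominates it.
          · obtain ⟨z, hz, hbz⟩ := hs b hb
            exact ⟨z, hz, _root_.trans hxb hbz⟩
      · simp at h; omega
    · intro h
      obtain ⟨y, hy, hxy⟩ := h x (by simp)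
      rw [if_pos ⟨y, by simp [hy], hxy⟩]
      exact ih.2 fun z hz => h z (by simp [hz])

/-- The branch grows by at most one node per letter, so some letter `x`, a record, takes its length
from `k` to `k + 1`. -/
theorem exists_split_of_lt_length_rightBranch {w : List α} {k : ℕ}
    (hk : k < (rightBranch (searchTree r w)).length) :
    ∃ u x v, w = u ++ x :: v ∧ (rightBranch (searchTree r u)).length = k ∧
      ∀ y ∈ u, ¬ r x y := by
  induction w using List.reverseRecOn with
  | nil => simp [searchTree, rightBranch] at hk
  | append_singleton w x ih =>
    by_cases h : k < (rightBranch (searchTree r w)).length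
    · obtain ⟨u, y, v, rfl, h1, h2⟩ := ih h
      exact ⟨u, y, v ++ [x], by simp, h1, h2⟩
    · rw [rightBranch_searchTree_concat] at hk
      split_ifs at hk with hx
      · exact absurd hk h
      · refine ⟨w, x, [], rfl, ?_, by simpa using hx⟩
        simp at hk; omega

end TreeInsertion

/-! ### Commuting insertions -/

section SearchPath

variable {α : Type*}

/-- The letter `c` is the label of a node on its own search path. -/
def OnSearchPath (r : α → α → Prop) [DecidableRel r] (c : α) : BinaryTree α → Prop
  | .nil => False
  | .node b s t => c = b ∨ if r c b then OnSearchPath r c s else OnSearchPath r c t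

theorem onSearchPath_leafInsert_self (r : α → α → Prop) [DecidableRel r] (c : α)
    (T : BinaryTree α) : OnSearchPath r c (leafInsert r c T) := by
  induction T with
  | nil => exact Or.inl rfl
  | node b s t ihs iht => by_cases h : r c b <;> simp_all [leafInsert, OnSearchPath]

theorem OnSearchPath.leafInsert {r : α → α → Prop} [DecidableRel r] {c : α} {T : BinaryTree α}
    (h : OnSearchPath r c T) (x : α) : OnSearchPath r c (leafInsert r x T) := by
  induction T with
  | nil => exact h.elim
  | node b s t ihs iht =>
    simp only [OnSearchPath] at h
    by_cases hx : r x b <;> by_cases hc : r c b <;>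
      simp only [hc, if_true, if_false] at h <;>
      simp only [Baxter.leafInsert, hx, hc, OnSearchPath, if_true, if_false] <;>
      first
        | exact h
        | exact h.imp_right ihs
        | exact h.imp_right iht

theorem onSearchPath_searchTree (r : α → α → Prop) [DecidableRel r] {c : α} {u : List α}
    (hc : c ∈ u) : OnSearchPath r c (searchTree r u) := by
  induction u using List.reverseRecOn with
  | nil => simp at hc
  | append_singleton u a ih =>
    rw [searchTree_concat]
    rcases List.mem_append.1 hc with hc | hc
    · exact (ih hc).leafInsert a
    · rw [List.mem_singleton.1 hc]; exact onSearchPath_leafInsert_self r a _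

/-- By `h` and `h'`, wherever `a` and `d` go the same way, `c` goes that way too. The node of `c` on
this path separates them at the latest, since there `a` goes left and `d` right. -/
theorem leafInsert_comm {r : α → α → Prop} [DecidableRel r] {a c d : α}
    (h : ∀ b, r d b → r c b) (h' : ∀ b, r c b → r a b) (hac : r a c) (hdc : ¬ r d c)
    {T : BinaryTree α} (hc : OnSearchPath r c T) :
    leafInsert r a (leafInsert r d T) = leafInsert r d (leafInsert r a T) := by
  induction T with
  | nil => exact hc.elim
  | node b s t ihs iht =>
    by_cases ha : r a b <;> by_cases hd : r d b
    · have hcb := h b hd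
      rcases hc with rfl | hc
      · exact absurd hd hdc
      · rw [if_pos hcb] at hc
        simp [leafInsert, ha, hd, ihs hc]
    · simp [leafInsert, ha, hd]
    · exact absurd (h' b (h b hd)) ha
    · have hcb : ¬ r c b := fun hcb => ha (h' b hcb)
      rcases hc with rfl | hc
      · exact absurd hac ha
      · rw [if_neg hcb] at hc
        simp [leafInsert, ha, hd, iht hc]

end SearchPath

/-! ### Baxter equivalence and the P-symbol -/

section Words

variable {α : Type*} [LinearOrder α]

/-- Exchange of two adjacent letters `a` and `d` of a word, that are separated both by an earlier
letter `c` and by a later letter `b`. -/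
inductive Swap : List α → List α → Prop
  | mk (p q : List α) (a b c d : α) (hc : c ∈ p) (hb : b ∈ q) (hac : a < c) (hcd : c ≤ d)
      (hab : a ≤ b) (hbd : b < d) : Swap (p ++ a :: d :: q) (p ++ d :: a :: q)

theorem Equivalent.refl (u : List α) : Equivalent u u := (congruence α).refl _

theorem Equivalent.symm {u v : List α} (h : Equivalent u v) : Equivalent v u :=
  (congruence α).symm h

theorem Equivalent.trans {u v w : List α} (h : Equivalent u v) (h' : Equivalent v w) :
    Equivalent u w :=
  (congruence α).trans h h'

theorem Equivalent.append_append {u v : List α} (h : Equivalent u v) (p q : List α) :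
    Equivalent (p ++ u ++ q) (p ++ v ++ q) :=
  (congruence α).mul ((congruence α).mul ((congruence α).refl (FreeMonoid.ofList p)) h)
    ((congruence α).refl (FreeMonoid.ofList q))

theorem Equivalent.of_adj {u v : List α} (h : Adj (FreeMonoid.ofList u) (FreeMonoid.ofList v)) :
    Equivalent u v :=
  ConGen.Rel.of _ _ h

/-- The two defining relations are the cases `b < c` and `c ≤ b`, the latter with the names `b` and
`c` interchanged. -/
theorem Swap.equivalent {u v : List α} (h : Swap u v) : Equivalent u v := by
  obtain ⟨p, q, a, b, c, d, hc, hb, hac, hcd, hab, hbd⟩ := h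
  obtain ⟨p₁, p₂, rfl⟩ := List.append_of_mem hc
  obtain ⟨q₁, q₂, rfl⟩ := List.append_of_mem hb
  rcases lt_or_ge b c with hbc | hcb
  · have := (Equivalent.of_adj (.left p₂ q₁ a b c d hab hbc hcd)).append_append p₁ q₂
    simpa using this
  · have := (Equivalent.of_adj (.right p₂ q₁ a c b d hac hcb hbd)).symm.append_append p₁ q₂
    simpa using this

theorem Swap.append_append {u v : List α} (h : Swap u v) (s t : List α) :
    Swap (s ++ u ++ t) (s ++ v ++ t) := by
  obtain ⟨p, q, a, b, c, d, hc, hb, hac, hcd, hab, hbd⟩ := h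
  have := Swap.mk (s ++ p) (q ++ t) a b c d (by simp [hc]) (by simp [hb]) hac hcd hab hbd
  simpa using this

theorem Swap.of_adj {u v : FreeMonoid α} (h : Adj u v) :
    Relation.EqvGen Swap u.toList v.toList := by
  cases h with
  | left u v a b c d hab hbc hcd =>
    have := Swap.mk (c :: u) (v ++ [b]) a b c d (by simp) (by simp) (hab.trans_lt hbc) hcd hab
      (hbc.trans_le hcd)
    exact .rel _ _ (by simpa using this)
  | right u v a b c d hab hbc hcd =>
    have := Swap.mk (b :: u) (v ++ [c]) a c b d (by simp) (by simp) hab (hbc.trans hcd.le)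
      (hab.le.trans hbc) hcd
    exact .symm _ _ (.rel _ _ (by simpa using this))

theorem eqvGen_swap_append_append {u v : List α} (h : Relation.EqvGen Swap u v)
    (s t : List α) : Relation.EqvGen Swap (s ++ u ++ t) (s ++ v ++ t) := by
  induction h with
  | rel u v h => exact .rel _ _ (h.append_append s t)
  | refl u => exact .refl _
  | symm u v _ ih => exact .symm _ _ ih
  | trans u v w _ _ ih ih' => exact .trans _ _ _ ih ih'

theorem equivalent_iff_eqvGen_swap {u v : List α} :
    Equivalent u v ↔ Relation.EqvGen Swap u v := by
  constructor
  · intro h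
    have key : ∀ x y : FreeMonoid α, ConGen.Rel Adj x y →
        Relation.EqvGen Swap x.toList y.toList := by
      intro x y h
      induction h with
      | of x y h => exact Swap.of_adj h
      | refl x => exact .refl _
      | symm _ ih => exact .symm _ _ ih
      | trans _ _ ih ih' => exact .trans _ _ _ ih ih'
      | @mul w x y z _ _ ih ih' =>
        have h1 := eqvGen_swap_append_append ih [] y.toList
        have h2 := eqvGen_swap_append_append ih' x.toList []
        simp only [List.nil_append, List.append_nil] at h1 h2
        exact .trans _ _ _ h1 h2
    exact key _ _ h
  · intro h
    induction h with
    | rel u v h => exact h.equivalent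
    | refl u => exact .refl _
    | symm u v _ ih => exact ih.symm
    | trans u v w _ _ ih ih' => exact ih.trans ih'

theorem Equivalent.perm {u v : List α} (h : Equivalent u v) : u.Perm v := by
  replace h := equivalent_iff_eqvGen_swap.1 h
  induction h with
  | rel u v h =>
    obtain ⟨p, q, a, b, c, d⟩ := h
    exact (List.Perm.swap d a q).append_left p
  | refl u => exact .refl _
  | symm u v _ ih => exact ih.symm
  | trans u v w _ _ ih ih' => exact ih.trans ih'

/-! ### The P-symbol in terms of search trees -/

theorem pSymbol_eq (u : List α) :
    pSymbol u = (searchTree (· < ·) u, searchTree (· ≤ ·) u.reverse) := by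
  have h1 : ∀ (a : α) T, leftInsert a T = leafInsert (· < ·) a T := fun a T => by
    induction T <;> simp_all [leftInsert, leafInsert]
  have h2 : ∀ (a : α) T, rightInsert a T = leafInsert (· ≤ ·) a T := fun a T => by
    induction T <;> simp_all [rightInsert, leafInsert]
  simp only [pSymbol, searchTree, List.foldl_reverse, h1]
  congr
  funext a T
  exact h2 a T

theorem isLeftBST_iff (T : BinaryTree α) : IsLeftBST T ↔ IsSearchTree (· < ·) T := by
  induction T <;> simp_all [IsLeftBST, IsSearchTree]

theorem isRightBST_iff (T : BinaryTree α) : IsRightBST T ↔ IsSearchTree (· ≤ ·) T := by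
  induction T <;> simp_all [IsRightBST, IsSearchTree]

theorem IsSearchTree.pairwise_le_inorder {r : α → α → Prop} (hr : ∀ a b, r a b → a ≤ b)
    (hr' : ∀ a b, ¬ r a b → b ≤ a) {T : BinaryTree α} (h : IsSearchTree r T) :
    (inorder T).Pairwise (· ≤ ·) := by
  induction T with
  | nil => simp [inorder]
  | node b s t ihs iht =>
    obtain ⟨h1, h2, h3, h4⟩ := h
    simp only [inorder, List.pairwise_append, List.pairwise_cons]
    refine ⟨ihs h3, ⟨fun c hc => hr' _ _ (h2 c hc), iht h4⟩, fun a ha c hc => ?_⟩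
    rcases List.mem_cons.1 hc with rfl | hc
    · exact hr _ _ (h1 a ha)
    · exact (hr _ _ (h1 a ha)).trans (hr' _ _ (h2 c hc))

/-- Both readings are sorted rearrangements of the letters of `u`. -/
theorem inorder_pSymbol (u : List α) : inorder (pSymbol u).1 = inorder (pSymbol u).2 := by
  rw [pSymbol_eq]
  refine List.Perm.eq_of_pairwise' (r := (· ≤ ·)) ?_ ?_
    ((inorder_searchTree_perm u).trans
      ((inorder_searchTree_perm _).trans u.reverse_perm).symm)
  · exact (isSearchTree_searchTree u).pairwise_le_inorder (fun _ _ => le_of_lt)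
      fun _ _ => le_of_not_gt
  · exact (isSearchTree_searchTree _).pairwise_le_inorder (fun _ _ => id)
      fun _ _ => le_of_not_ge

/-- Taking the last occurrence makes the ties agree with both insertion rules: equal letters lie in
`u` only, and they precede `a` in inorder in both trees. -/
theorem exists_split_max {w : List α} (hw : w ≠ []) :
    ∃ u a v, w = u ++ a :: v ∧ (∀ x ∈ u, x ≤ a) ∧ ∀ x ∈ v, x < a := by
  induction w using List.reverseRecOn with
  | nil => exact absurd rfl hw
  | append_singleton w b ih =>
    by_cases h : ∀ x ∈ w, x ≤ b
    · exact ⟨w, b, [], rfl, h, by simp⟩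
    · push Not at h
      obtain ⟨x, hx, hbx⟩ := h
      obtain ⟨u, a, v, rfl, hu, hv⟩ := ih (List.ne_nil_of_mem hx)
      have hxa : x ≤ a := by
        simp only [List.mem_append, List.mem_cons] at hx
        rcases hx with hx | rfl | hx
        exacts [hu x hx, le_rfl, (hv x hx).le]
      refine ⟨u, a, v ++ [b], by simp, hu, fun y hy => ?_⟩
      rcases List.mem_append.1 hy with hy | hy
      · exact hv y hy
      · rw [List.mem_singleton.1 hy]; exact hbx.trans_le hxa

/-- The number of nodes on the right branch of the tree inserted from left to right. -/
def leftDepth (u : List α) : ℕ := (rightBranch (searchTree (· < ·) u)).length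

/-- The number of nodes on the right branch of the tree inserted from right to left. -/
def rightDepth (u : List α) : ℕ := (rightBranch (searchTree (· ≤ ·) u.reverse)).length

theorem leftDepth_le_append (u v : List α) : leftDepth u ≤ leftDepth (u ++ v) :=
  length_rightBranch_le_append u v

theorem rightDepth_le_append (u v : List α) : rightDepth v ≤ rightDepth (u ++ v) := by
  rw [rightDepth, rightDepth, List.reverse_append]
  exact length_rightBranch_le_append _ _

theorem leftDepth_eq_append_iff {u s : List α} :
    leftDepth u = leftDepth (u ++ s) ↔ ∀ x ∈ s, ∃ y ∈ u, x < y :=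
  length_rightBranch_append_eq_iff

theorem rightDepth_eq_append_iff {s v : List α} :
    rightDepth v = rightDepth (s ++ v) ↔ ∀ x ∈ s, ∃ y ∈ v, x ≤ y := by
  rw [rightDepth, rightDepth, List.reverse_append, length_rightBranch_append_eq_iff]
  simp

theorem pSymbol_append_cons {u v : List α} {a : α} (hu : ∀ x ∈ u, x ≤ a) (hv : ∀ x ∈ v, x < a) :
    pSymbol (u ++ a :: v) =
      (cutInsert a (leftDepth u) (pSymbol (u ++ v)).1,
        cutInsert a (rightDepth v) (pSymbol (u ++ v)).2) := by
  simp only [pSymbol_eq]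
  rw [searchTree_append_cons (fun x hx => (hu x hx).not_gt) hv, List.reverse_append,
    List.reverse_cons, List.append_assoc, List.singleton_append,
    searchTree_append_cons (fun x hx => (hv x (by simpa using hx)).not_ge)
      (fun x hx => hu x (by simpa using hx)), ← List.reverse_append]
  rfl

theorem pSymbol_append_cons_injective {u v u' v' : List α} {a a' : α} (hu : ∀ x ∈ u, x ≤ a)
    (hv : ∀ x ∈ v, x < a) (hu' : ∀ x ∈ u', x ≤ a') (hv' : ∀ x ∈ v', x < a')
    (h : pSymbol (u ++ a :: v) = pSymbol (u' ++ a' :: v')) :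
    a = a' ∧ pSymbol (u ++ v) = pSymbol (u' ++ v') ∧ leftDepth u = leftDepth u' ∧
      rightDepth v = rightDepth v' := by
  rw [pSymbol_append_cons hu hv, pSymbol_append_cons hu' hv', Prod.mk.injEq] at h
  have key : ∀ s t : List α, leftDepth s ≤ (rightBranch (pSymbol (s ++ t)).1).length ∧
      rightDepth t ≤ (rightBranch (pSymbol (s ++ t)).2).length := fun s t => by
    rw [pSymbol_eq]
    exact ⟨leftDepth_le_append s t, rightDepth_le_append s t⟩
  obtain ⟨h1, h2, h3⟩ := cutInsert_injective (key u v).1 (key u' v').1 h.1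
  obtain ⟨-, h4, h5⟩ := cutInsert_injective (key u v).2 (key u' v').2 h.2
  exact ⟨h1, Prod.ext h3 h5, h2, h4⟩

/-! ### Invariance of the P-symbol -/

theorem Swap.pSymbol_eq {u v : List α} (h : Swap u v) : pSymbol u = pSymbol v := by
  obtain ⟨p, q, a, b, c, d, hc, hb, hac, hcd, hab, hbd⟩ := h
  have key : ∀ (r : α → α → Prop) [DecidableRel r] (s t : List α) (x y : α),
      leafInsert r y (leafInsert r x (searchTree r s)) =
        leafInsert r x (leafInsert r y (searchTree r s)) →
      searchTree r (s ++ x :: y :: t) = searchTree r (s ++ y :: x :: t) := by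
    intro r _ s t x y h
    simp only [searchTree, List.foldl_append, List.foldl_cons] at h ⊢
    rw [h]
  rw [Baxter.pSymbol_eq, Baxter.pSymbol_eq]
  congr 1
  -- The separating letter already in the tree is `c` for the left tree and `b` for the right tree.
  · refine key _ _ _ _ _ (leafInsert_comm (c := c) ?_ ?_ hac hcd.not_gt
      (onSearchPath_searchTree _ hc)).symm
    exacts [fun b h => hcd.trans_lt h, fun b h => hac.trans h]
  · simp only [List.reverse_append, List.reverse_cons, List.append_assoc, List.cons_append,
      List.nil_append]
    refine key _ _ _ _ _ (leafInsert_comm (c := b) ?_ ?_ hab hbd.not_ge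
      (onSearchPath_searchTree _ (by simpa using hb)))
    exacts [fun c h => hbd.le.trans h, fun c h => hab.trans h]

theorem Equivalent.pSymbol_eq {u v : List α} (h : Equivalent u v) : pSymbol u = pSymbol v := by
  replace h := equivalent_iff_eqvGen_swap.1 h
  induction h with
  | rel u v h => exact h.pSymbol_eq
  | refl u => rfl
  | symm u v _ ih => exact ih.symm
  | trans u v w _ _ ih ih' => exact ih.trans ih'

/-! ### Moving a maximal letter -/

/-- Each `x` of `s` is passed by a `Swap` in which `a` is the larger letter and `y`, `z` are the
separating ones. -/
theorem equivalent_move_max {a : α} {u s v : List α} (hs : ∀ x ∈ s, ∃ y ∈ u, x < y ∧ y ≤ a)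
    (hs' : ∀ x ∈ s, ∃ z ∈ v, x ≤ z ∧ z < a) :
    Equivalent (u ++ a :: (s ++ v)) (u ++ s ++ a :: v) := by
  induction s generalizing u with
  | nil => simpa using Equivalent.refl _
  | cons x s ih =>
    obtain ⟨y, hy, hxy, hya⟩ := hs x (by simp)
    obtain ⟨z, hz, hxz, hza⟩ := hs' x (by simp)
    have h1 := (Swap.mk u (s ++ v) x z y a hy (by simp [hz]) hxy hya hxz hza).equivalent.symm
    have h2 := ih (u := u ++ [x])
      (fun x' hx' => (hs x' (by simp [hx'])).imp fun y h => ⟨by simp [h.1], h.2⟩)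
      (fun x' hx' => hs' x' (by simp [hx']))
    exact h1.trans (by simpa using h2)

/-- Every insertion of the letter `m` into `w`, as the last occurrence of the maximal letter, is
Baxter equivalent to such an insertion into `w'`. -/
def InsertMaxLift (m : α) (w w' : List α) : Prop :=
  ∀ u v, w = u ++ v → (∀ x ∈ u, x ≤ m) → (∀ x ∈ v, x < m) →
    ∃ u' v', w' = u' ++ v' ∧ (∀ x ∈ u', x ≤ m) ∧ (∀ x ∈ v', x < m) ∧
      Equivalent (u ++ m :: v) (u' ++ m :: v')

/-- Only an insertion of `m` between the exchanged letters matters. Since `d ≤ m`, the letters `c`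
and `b` also separate `a` from `m`; so `m` first passes `a`, after which `a` and `d` are adjacent
and can be exchanged. -/
theorem Swap.insertMaxLift {w w' : List α} (h : Swap w w') (m : α) :
    InsertMaxLift m w w' ∧ InsertMaxLift m w' w := by
  obtain ⟨p, q, a, b, c, d, hc, hb, hac, hcd, hab, hbd⟩ := h
  have sw := Swap.mk p q a b c d hc hb hac hcd hab hbd
  constructor <;> intro u v h hu hv <;>
    rcases append_eq_append_cons_cons h.symm with ⟨e, rfl, rfl⟩ | ⟨rfl, rfl⟩ | ⟨e, rfl, rfl⟩
  · refine ⟨p ++ d :: a :: e, v, by simp, fun x hx => hu x ?_, hv, ?_⟩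
    · simp at hx ⊢; tauto
    · have := Swap.mk p (e ++ m :: v) a b c d hc (by simp at hb ⊢; tauto) hac hcd hab hbd
      simpa using this.equivalent
  · have hdm := hv d (by simp)
    refine ⟨p, d :: a :: q, rfl, fun x hx => hu x (by simp [hx]), ?_, ?_⟩
    · have := hac.trans_le hcd |>.trans hdm
      simpa [hdm, this] using fun x hx => hv x (by simp [hx])
    · have h1 := Swap.mk p (d :: q) a b c m hc (by simp [hb]) hac (hcd.trans hdm.le) hab
        (hbd.trans hdm)
      have h2 := Swap.mk (p ++ [m]) q a b c d (by simp [hc]) hb hac hcd hab hbd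
      have := h1.equivalent.trans (by simpa using h2.equivalent)
      simpa using this
  · refine ⟨u, e ++ d :: a :: q, by simp, hu, fun x hx => hv x ?_, ?_⟩
    · simp at hx ⊢; tauto
    · have := Swap.mk (u ++ m :: e) q a b c d (by simp at hc ⊢; tauto) hb hac hcd hab hbd
      simpa using this.equivalent
  · refine ⟨p ++ a :: d :: e, v, by simp, fun x hx => hu x ?_, hv, ?_⟩
    · simp at hx ⊢; tauto
    · have := Swap.mk p (e ++ m :: v) a b c d hc (by simp at hb ⊢; tauto) hac hcd hab hbd
      simpa using this.equivalent.symm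
  · have hdm := hu d (by simp)
    refine ⟨p ++ [a, d], q, by simp, ?_, fun x hx => hv x (by simp [hx]), ?_⟩
    · have := (hac.trans_le hcd).le.trans hdm
      intro x hx
      simp only [List.mem_append, List.mem_cons, List.not_mem_nil, or_false] at hx
      rcases hx with hx | rfl | rfl
      exacts [hu x (by simp [hx]), this, hdm]
    · have h1 := Swap.mk (p ++ [d]) q a b c m (by simp [hc]) hb hac (hcd.trans hdm) hab
        (hbd.trans_le hdm)
      have h2 := Swap.mk p (m :: q) a b c d hc (by simp [hb]) hac hcd hab hbd
      have := h1.equivalent.symm.trans (by simpa using h2.equivalent.symm)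
      simpa using this
  · refine ⟨u, e ++ a :: d :: q, by simp, hu, fun x hx => hv x ?_, ?_⟩
    · simp at hx ⊢; tauto
    · have := Swap.mk (u ++ m :: e) q a b c d (by simp at hc ⊢; tauto) hb hac hcd hab hbd
      simpa using this.equivalent.symm

theorem Equivalent.insertMaxLift {w w' : List α} (h : Equivalent w w') (m : α) :
    InsertMaxLift m w w' := by
  replace h := equivalent_iff_eqvGen_swap.1 h
  have tr : ∀ {x y z : List α}, InsertMaxLift m x y → InsertMaxLift m y z →
      InsertMaxLift m x z := by
    intro x y z h h' u v e hu hv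
    obtain ⟨u₁, v₁, e₁, hu₁, hv₁, h₁⟩ := h u v e hu hv
    obtain ⟨u₂, v₂, e₂, hu₂, hv₂, h₂⟩ := h' u₁ v₁ e₁ hu₁ hv₁
    exact ⟨u₂, v₂, e₂, hu₂, hv₂, h₁.trans h₂⟩
  suffices H : InsertMaxLift m w w' ∧ InsertMaxLift m w' w from H.1
  induction h with
  | rel u v h => exact h.insertMaxLift m
  | refl w => exact ⟨fun u v e hu hv => ⟨u, v, e, hu, hv, .refl _⟩,
      fun u v e hu hv => ⟨u, v, e, hu, hv, .refl _⟩⟩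
  | symm u v _ ih => exact ih.symm
  | trans u v w _ _ ih ih' => exact ⟨tr ih.1 ih'.1, tr ih'.2 ih.2⟩

theorem equivalent_of_depth_eq {u v u' v' : List α} {m : α} (hu : ∀ x ∈ u, x ≤ m)
    (hv : ∀ x ∈ v, x < m) (hu' : ∀ x ∈ u', x ≤ m) (hv' : ∀ x ∈ v', x < m)
    (h : u ++ v = u' ++ v') (hl : leftDepth u = leftDepth u')
    (hr : rightDepth v = rightDepth v') : Equivalent (u ++ m :: v) (u' ++ m :: v') := by
  rcases List.append_eq_append_iff.1 h with ⟨s, rfl, rfl⟩ | ⟨s, rfl, rfl⟩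
  · exact equivalent_move_max
      (fun x hx => (leftDepth_eq_append_iff.1 hl x hx).imp fun y h => ⟨h.1, h.2, hu y h.1⟩)
      (fun x hx => (rightDepth_eq_append_iff.1 hr.symm x hx).imp
        fun y h => ⟨h.1, h.2, hv' y h.1⟩)
  · exact (equivalent_move_max
      (fun x hx => (leftDepth_eq_append_iff.1 hl.symm x hx).imp
        fun y h => ⟨h.1, h.2, hu' y h.1⟩)
      (fun x hx => (rightDepth_eq_append_iff.1 hr x hx).imp
        fun y h => ⟨h.1, h.2, hv y h.1⟩)).symm

theorem numNodes_pSymbol (u : List α) :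
    (pSymbol u).1.numNodes = u.length ∧ (pSymbol u).2.numNodes = u.length := by
  rw [pSymbol_eq, ← length_inorder, ← length_inorder, (inorder_searchTree_perm _).length_eq,
    (inorder_searchTree_perm _).length_eq]
  simp

theorem length_eq_of_pSymbol_eq {w w' : List α} (h : pSymbol w = pSymbol w') :
    w.length = w'.length := by
  rw [← (numNodes_pSymbol w).1, h, (numNodes_pSymbol w').1]

theorem equivalent_of_pSymbol_eq {w w' : List α} (h : pSymbol w = pSymbol w') :
    Equivalent w w' := by
  induction hn : w.length generalizing w w' with
  | zero =>
    have := length_eq_of_pSymbol_eq h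
    rw [List.length_eq_zero_iff.1 hn, List.length_eq_zero_iff.1 (this.symm.trans hn)]
    exact .refl _
  | succ n ih =>
    have hn' := (length_eq_of_pSymbol_eq h).symm.trans hn
    obtain ⟨u, a, v, rfl, hu, hv⟩ :=
      exists_split_max (List.ne_nil_of_length_eq_add_one hn)
    obtain ⟨u', a', v', rfl, hu', hv'⟩ :=
      exists_split_max (List.ne_nil_of_length_eq_add_one hn')
    obtain ⟨rfl, h1, h2, h3⟩ := pSymbol_append_cons_injective hu hv hu' hv' h
    have e := ih h1 (by simp at hn ⊢; omega)
    obtain ⟨u₁, v₁, e₁, hu₁, hv₁, h₁⟩ := e.insertMaxLift a u v rfl hu hv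
    -- The lift preserves the P-symbol, hence the depths: what remains are two insertions of `a`
    -- into one word with equal depths.
    obtain ⟨-, -, h2', h3'⟩ := pSymbol_append_cons_injective hu hv hu₁ hv₁ h₁.pSymbol_eq
    exact h₁.trans (equivalent_of_depth_eq hu₁ hv₁ hu' hv' e₁.symm (h2'.symm.trans h2)
      (h3'.symm.trans h3))

/-! ### The image of the P-symbol -/

/-- The last occurrence of the maximum lies either in `u`, and then only the left depth is full, or
in `v`, and then only the right one is. -/
theorem leftDepth_eq_xor_rightDepth_eq {u v : List α} (h : u ++ v ≠ []) :
    ¬ (leftDepth u = leftDepth (u ++ v) ↔ rightDepth v = rightDepth (u ++ v)) := by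
  rw [leftDepth_eq_append_iff, rightDepth_eq_append_iff]
  obtain ⟨p, a, q, h, hp, hq⟩ := exists_split_max h
  rcases List.append_eq_append_iff.1 h with ⟨s, rfl, rfl⟩ | ⟨s, rfl, hs⟩
  · intro H
    obtain ⟨y, hy, hay⟩ := H.2 (fun x hx => ⟨a, by simp, hp x (by simp [hx])⟩) a (by simp)
    exact hay.not_ge (hp y (by simp [hy]))
  · rcases s with _ | ⟨b, s⟩
    · obtain rfl : v = a :: q := by simpa using hs.symm
      intro H
      obtain ⟨y, hy, hay⟩ := H.2 (fun x hx => ⟨a, by simp, hp x (by simpa using hx)⟩) a (by simp)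
      exact hay.not_ge (hp y (by simpa using hy))
    · obtain ⟨rfl, rfl⟩ : a = b ∧ q = s ++ v := by simpa using hs
      intro H
      obtain ⟨y, hy, hay⟩ := H.1 (fun x hx => ⟨a, by simp, hq x (by simp [hx])⟩) a (by simp)
      exact hay.not_gt (hq y (by simp [hy]))

theorem canopy_pSymbol (w : List α) :
    List.Forall₂ (fun x y => x ≠ y) (canopy (pSymbol w).1) (canopy (pSymbol w).2) := by
  induction hn : w.length generalizing w with
  | zero => rw [List.length_eq_zero_iff.1 hn]; exact .nil
  | succ n ih =>
    obtain ⟨u, a, v, rfl, hu, hv⟩ :=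
      exists_split_max (List.ne_nil_of_length_eq_add_one hn)
    rw [pSymbol_append_cons hu hv]
    by_cases h : u ++ v = []
    · rw [h]
      simp [pSymbol, canopy_cutInsert_nil]
    · have := ih (u ++ v) (by simp at hn ⊢; omega)
      have hx := leftDepth_eq_xor_rightDepth_eq h
      rw [pSymbol_eq] at this ⊢
      simp only
      rw [canopy_cutInsert a (searchTree_ne_nil h) (leftDepth_le_append u v),
        canopy_cutInsert a (searchTree_ne_nil (mt List.reverse_eq_nil_iff.1 h))
          (rightDepth_le_append u v)]
      refine List.rel_append this (.cons ?_ .nil)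
      rw [Ne, decide_eq_decide]
      exact hx

theorem pSymbol_mem_twinSearchTrees (w : List α) : pSymbol w ∈ twinSearchTrees α w.length := by
  refine ⟨⟨(numNodes_pSymbol w).1, (numNodes_pSymbol w).2, canopy_pSymbol w⟩, ?_, ?_,
    inorder_pSymbol w⟩
  · rw [isLeftBST_iff, pSymbol_eq]; exact isSearchTree_searchTree w
  · rw [isRightBST_iff, pSymbol_eq]; exact isSearchTree_searchTree _

/-- In the first case `a` goes just before the record `x` that enters the right branch at depth `k`;
as `x` bounds all earlier letters, the right depth is full. The second case is the mirror image: `a`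
goes just after a strict record from the right. The third is the base of the induction. -/
theorem exists_pSymbol_eq_cutInsert {w : List α} {a : α} {k l : ℕ}
    (hw : ∀ x ∈ w, x ≤ a)
    (h : (k < leftDepth w ∧ (∀ x ∈ w, x < a) ∧ l = rightDepth w) ∨
      (k = leftDepth w ∧ l < rightDepth w) ∨ (w = [] ∧ k = 0 ∧ l = 0)) :
    ∃ w', pSymbol w' = (cutInsert a k (pSymbol w).1, cutInsert a l (pSymbol w).2) := by
  rcases h with ⟨hk, hlt, rfl⟩ | ⟨rfl, hl⟩ | ⟨rfl, rfl, rfl⟩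
  · obtain ⟨u, x, v, rfl, hu, hx⟩ := exists_split_of_lt_length_rightBranch hk
    refine ⟨u ++ a :: x :: v, ?_⟩
    rw [pSymbol_append_cons (fun y hy => hw y (by simp [hy]))
      (fun y hy => hlt y (List.mem_append_right u hy)), ← hu,
      rightDepth_eq_append_iff.2 fun y hy => ⟨x, by simp, le_of_not_gt (hx y hy)⟩]
    rfl
  · obtain ⟨v, x, u, h, hv, hx⟩ := exists_split_of_lt_length_rightBranch hl
    obtain rfl : w = (u.reverse ++ [x]) ++ v.reverse := by
      rw [← List.reverse_reverse w, h]; simp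
    have hx' : ∀ y ∈ v.reverse, y < x := fun y hy => lt_of_not_ge (hx y (by simpa using hy))
    refine ⟨(u.reverse ++ [x]) ++ a :: v.reverse, ?_⟩
    rw [pSymbol_append_cons (fun y hy => hw y (List.mem_append_left _ hy))
      (fun y hy => (hx' y hy).trans_le (hw x (by simp))),
      leftDepth_eq_append_iff.2 fun y hy => ⟨x, by simp, hx' y hy⟩, rightDepth,
      List.reverse_reverse, hv]
  · exact ⟨[a], rfl⟩

theorem exists_pSymbol_eq {n : ℕ} {J : BinaryTree α × BinaryTree α}
    (hJ : J ∈ twinSearchTrees α n) : ∃ w, w.length = n ∧ pSymbol w = J := by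
  suffices H : ∃ w, pSymbol w = J by
    obtain ⟨w, rfl⟩ := H
    exact ⟨w, (numNodes_pSymbol w).1.symm.trans hJ.1.1, rfl⟩
  induction n generalizing J with
  | zero =>
    obtain ⟨⟨h1, h2, -⟩, -⟩ := hJ
    obtain ⟨T, T'⟩ := J
    cases T <;> cases T' <;> simp at h1 h2
    exact ⟨[], rfl⟩
  | succ n ih =>
    obtain ⟨⟨h1, h2, h3⟩, hL, hR, hin⟩ := hJ
    obtain ⟨T₁, T₂⟩ := J
    simp only at h1 h2 h3 hL hR hin
    obtain ⟨a, k, T, hk, rfl⟩ := exists_eq_cutInsert (T := T₁) (by rintro rfl; simp at h1)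
    obtain ⟨b, l, T', hl, rfl⟩ := exists_eq_cutInsert (T := T₂) (by rintro rfl; simp at h2)
    rw [isLeftBST_iff] at hL
    rw [isRightBST_iff] at hR
    have hsort := hL.pairwise_le_inorder (fun _ _ => le_of_lt) fun _ _ => le_of_not_gt
    rw [inorder_cutInsert, List.pairwise_append] at hsort
    rw [inorder_cutInsert, inorder_cutInsert] at hin
    obtain ⟨hTT', rfl⟩ : inorder T = inorder T' ∧ a = b := by simpa using hin
    rw [← length_inorder, inorder_cutInsert, List.length_append, length_inorder] at h1 h2
    simp only [List.length_singleton, add_left_inj] at h1 h2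
    by_cases hT : T = .nil
    · subst hT
      obtain rfl : n = 0 := h1.symm
      obtain rfl : T' = .nil := by cases T' <;> simp at h2 ⊢
      obtain rfl : k = 0 := by simpa [rightBranch] using hk
      obtain rfl : l = 0 := by simpa [rightBranch] using hl
      exact exists_pSymbol_eq_cutInsert (w := []) (by simp) (by simp)
    have hT' : T' ≠ .nil := by
      rintro rfl
      cases T
      · exact hT rfl
      · simp [← h2] at h1
    rw [canopy_cutInsert a hT hk, canopy_cutInsert a hT' hl] at h3
    -- Reversal exposes the last canopy letters; their difference says that exactly one of `k`, `l`
    -- is full.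
    rw [← List.forall₂_reverse_iff, List.reverse_append, List.reverse_append,
      List.reverse_singleton, List.reverse_singleton, List.singleton_append,
      List.singleton_append, List.forall₂_cons, List.forall₂_reverse_iff, Ne,
      decide_eq_decide] at h3
    obtain ⟨w, hw⟩ := ih (J := (T, T')) ⟨⟨h1, h2, h3.2⟩, (isLeftBST_iff T).2 hL.of_cutInsert,
      (isRightBST_iff T').2 hR.of_cutInsert, hTT'⟩
    have hwT : (inorder T).Perm w := by
      have := inorder_searchTree_perm (r := (· < ·)) w
      rwa [show searchTree (· < ·) w = T from (congrArg Prod.fst (pSymbol_eq w)).symm.trans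
        (congrArg Prod.fst hw)] at this
    have hk' : leftDepth w = (rightBranch T).length := by
      rw [show T = (pSymbol w).1 by rw [hw], pSymbol_eq]; rfl
    have hl' : rightDepth w = (rightBranch T').length := by
      rw [show T' = (pSymbol w).2 by rw [hw], pSymbol_eq]; rfl
    obtain ⟨w', hw'⟩ := exists_pSymbol_eq_cutInsert (w := w) (a := a) (k := k) (l := l)
      (fun x hx => hsort.2.2 x (hwT.mem_iff.2 hx) a (by simp)) (by
        rcases hk.lt_or_eq with hk | hk
        · refine Or.inl ⟨hk' ▸ hk, fun x hx => ?_, ?_⟩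
          · refine IsSearchTree.rel_of_cutInsert_lt (r := (· < ·)) ?_ hk hL x
              (hwT.mem_iff.2 hx)
            exact fun a b c h h' => (le_of_not_gt h').trans_lt h
          · rw [hl']
            by_contra h
            exact h3.1 ⟨fun e => absurd e hk.ne, fun e => absurd e h⟩
        · refine Or.inr (Or.inl ⟨hk'.symm ▸ hk, ?_⟩)
          rw [hl']
          exact hl.lt_of_ne fun e => h3.1 ⟨fun _ => e, fun _ => hk⟩)
    exact ⟨w', by rw [hw', hw]⟩

end Words

/-! ### Baxter words as representatives -/

section BaxterWords

variable {α : Type*} [LinearOrder α]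

/-- Words that avoid the generalized patterns `2-41-3` and `3-14-2`. -/
def IsBaxterWord (w : List α) : Prop :=
  ∀ p x y q, w = p ++ x :: y :: q → ∀ c ∈ p, ∀ b ∈ q,
    ¬ (y < c ∧ c < b ∧ b < x) ∧ ¬ (x < b ∧ b < c ∧ c < y)

theorem IsBaxterWord.reverse {w : List α} (h : IsBaxterWord w) : IsBaxterWord w.reverse := by
  intro p x y q e c hc b hb
  have := h q.reverse y x p.reverse (by rw [← List.reverse_reverse w, e]; simp) b
    (by simpa using hb) c (by simpa using hc)
  exact ⟨fun H => this.2 ⟨H.1, H.2.1, H.2.2⟩, fun H => this.1 ⟨H.1, H.2.1, H.2.2⟩⟩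

/-- If deleting `m` makes `x` and `y` adjacent, `m` can replace the larger of them in a pattern. -/
theorem IsBaxterWord.of_insert_max {u v : List α} {m : α} (h : IsBaxterWord (u ++ m :: v))
    (hm : ∀ x ∈ u ++ v, x < m) : IsBaxterWord (u ++ v) := by
  intro p x y q he c hc b hb
  rcases append_eq_append_cons_cons he with ⟨e, rfl, rfl⟩ | ⟨rfl, rfl⟩ | ⟨e, rfl, rfl⟩
  · refine h p x y (e ++ m :: v) (by simp) c hc b ?_
    simp at hb ⊢; tauto
  · have hbm := hm b (by simp [hb])
    have hcm := hm c (by simp [hc])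
    have h1 := h p x m (y :: q) (by simp) c hc b (by simp [hb])
    have h2 := h (p ++ [x]) m y q (by simp) c (by simp [hc]) b hb
    exact ⟨fun H => h2.1 ⟨H.1, H.2.1, hbm⟩, fun H => h1.2 ⟨H.1, H.2.1, hcm⟩⟩
  · refine h (u ++ m :: e) x y q (by simp) c ?_ b hb
    simp at hc ⊢; tauto

/-- In a pattern `m` can only be the `4`. The pair `m x` would need an earlier letter above `x`; in
a pattern using the pair that ends in `m`, the letter `x` could replace `m`, as it exceeds all of
`p`. -/
theorem IsBaxterWord.insert_before {p q : List α} {x m : α} (h : IsBaxterWord (p ++ x :: q))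
    (hp : ∀ y ∈ p, y < x) (hm : ∀ y ∈ p ++ x :: q, y < m) :
    IsBaxterWord (p ++ m :: x :: q) := by
  intro p' x' y' q' he c hc b hb
  rcases append_eq_append_cons_cons he with ⟨e, rfl, rfl⟩ | ⟨rfl, e'⟩ | ⟨e, rfl, e'⟩
  · simp only [List.mem_append, List.mem_cons] at hb
    by_cases hbm : b = m
    · have hx := hm x' (by simp)
      have hcm := hm c (by simp [hc])
      subst hbm
      exact ⟨fun H => H.2.2.not_gt hx, fun H => H.2.1.not_gt hcm⟩
    · exact h p' x' y' (e ++ x :: q) (by simp) c hc b (by simp; tauto)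
  · obtain ⟨rfl, rfl⟩ : m = y' ∧ x :: q = q' := by simpa using e'
    have hcx := hp c (by simp [hc])
    refine ⟨fun H => H.1.not_gt (hm c (by simp [hc])), fun H => ?_⟩
    rcases List.mem_cons.1 hb with rfl | hb
    · exact H.2.1.not_gt hcx
    · exact (h p' x' x q (by simp) c hc b hb).2 ⟨H.1, H.2.1, hcx⟩
  · rcases e with _ | ⟨z, e⟩
    · obtain ⟨rfl, rfl, rfl⟩ : m = x' ∧ x = y' ∧ q = q' := by simpa using e'
      exact ⟨fun H => H.1.not_gt (hp c (by simpa using hc)),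
        fun H => H.1.not_gt (hm b (by simp [hb]))⟩
    · obtain ⟨rfl, e₁⟩ : m = z ∧ x :: q = e ++ x' :: y' :: q' := by simpa using e'
      have hy : y' < m := hm y' (by rw [e₁]; simp)
      have hbm : b < m := hm b (by rw [e₁]; simp [hb])
      by_cases hcm : c = m
      · subst hcm
        exact ⟨fun H => H.2.1.not_gt hbm, fun H => H.2.2.not_gt hy⟩
      · refine h (p ++ e) x' y' q' (by rw [e₁, List.append_assoc]) c ?_ b hb
        simp at hc ⊢; tauto

theorem IsBaxterWord.insert_after {p q : List α} {x m : α} (h : IsBaxterWord (p ++ x :: q))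
    (hq : ∀ y ∈ q, y < x) (hm : ∀ y ∈ p ++ x :: q, y < m) :
    IsBaxterWord (p ++ x :: m :: q) := by
  have h' : IsBaxterWord (q.reverse ++ x :: p.reverse) := by simpa using h.reverse
  have := (h'.insert_before (m := m) (by simpa using hq) (by
    intro y hy; refine hm y ?_; simp at hy ⊢; tauto)).reverse
  simpa using this

theorem lt_max_of_nodup {u v : List α} {m : α} (h : (u ++ m :: v).Nodup)
    (hm : ∀ x ∈ u ++ v, x ≤ m) : ∀ x ∈ u ++ v, x < m := by
  have h' := (List.nodup_cons.1 (List.perm_middle.nodup_iff.1 h)).1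
  exact fun x hx => (hm x hx).lt_of_ne fun e => h' (e ▸ hx)

theorem exists_equivalent_isBaxterWord {w : List α} (hw : w.Nodup) :
    ∃ w', Equivalent w w' ∧ IsBaxterWord w' := by
  induction hn : w.length generalizing w with
  | zero =>
    refine ⟨w, .refl _, ?_⟩
    rw [List.length_eq_zero_iff.1 hn]
    intro p x y q h
    simp at h
  | succ n ih =>
    obtain ⟨u₀, m, v₀, rfl, hu₀, hv₀⟩ :=
      exists_split_max (List.ne_nil_of_length_eq_add_one hn)
    have hw₀ := (List.nodup_cons.1 (List.perm_middle.nodup_iff.1 hw)).2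
    obtain ⟨w', hw', hB⟩ := ih hw₀ (by simp at hn ⊢; omega)
    obtain ⟨u, v, rfl, hu, hv, he⟩ := hw'.insertMaxLift m u₀ v₀ rfl hu₀ hv₀
    have hnd := he.perm.nodup_iff.1 hw
    have hnd' := hw'.perm.nodup_iff.1 hw₀
    have hm := lt_max_of_nodup hnd fun x hx =>
      (List.mem_append.1 hx).elim (hu x) fun hx => (hv x hx).le
    by_cases hemp : u ++ v = []
    · obtain ⟨rfl, rfl⟩ := List.append_eq_nil_iff.1 hemp
      refine ⟨_, he, ?_⟩
      intro p x y q h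
      have := congrArg List.length h
      simp at this; omega
    obtain ⟨p, M, q, hM, hp, hq⟩ := exists_split_max hemp
    have hle : ∀ x ∈ u ++ v, x ≤ M := by
      rw [hM]
      intro x hx
      simp only [List.mem_append, List.mem_cons] at hx
      rcases hx with hx | rfl | hx
      exacts [hp x hx, le_rfl, (hq x hx).le]
    have hne : ∀ x ∈ u, ∀ y ∈ v, x ≠ y := fun x hx y hy =>
      (List.nodup_append.1 hnd').2.2 x hx y hy
    -- If the maximum of the rest is in `u`, then `m` moves left to just after the last letter of
    -- `u` exceeding all of `v`; otherwise it moves right to just before the first letter of `v`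
    -- exceeding all of `u`.
    rcases List.mem_append.1 (show M ∈ u ++ v by rw [hM]; simp) with hMu | hMv
    · obtain ⟨s, x, t, e, hx, hs⟩ := exists_first_split (P := fun x => ∀ y ∈ v, y < x)
        (v := u.reverse) ⟨M, by simpa using hMu, fun y hy =>
          (hle y (by simp [hy])).lt_of_ne (hne M hMu y hy).symm⟩
      obtain rfl : u = t.reverse ++ x :: s.reverse := by
        rw [← List.reverse_reverse u, e]; simp
      have hs' : ∀ y ∈ s.reverse, ∃ z ∈ v, y ≤ z := fun y hy => by
        have := hs y (by simpa using hy)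
        push Not at this
        exact this
      have hsx : ∀ y ∈ s.reverse, y < x := fun y hy =>
        (hs' y hy).elim fun z h => h.2.trans_lt (hx z h.1)
      have hmove := equivalent_move_max (a := m) (u := t.reverse ++ [x])
        (fun y hy => ⟨x, by simp, hsx y hy, hu x (by simp)⟩)
        (fun y hy => (hs' y hy).imp fun z h => ⟨h.1, h.2, hv z h.1⟩)
      refine ⟨t.reverse ++ x :: m :: (s.reverse ++ v), he.trans (by simpa using hmove.symm), ?_⟩
      refine IsBaxterWord.insert_after (by simpa using hB) (fun y hy => ?_) (by simpa using hm)
      exact (List.mem_append.1 hy).elim (hsx y) (hx y)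
    · obtain ⟨s, x, t, rfl, hx, hs⟩ := exists_first_split (P := fun x => ∀ y ∈ u, y < x)
        ⟨M, hMv, fun y hy => (hle y (by simp [hy])).lt_of_ne (hne y hy M hMv)⟩
      have hs' : ∀ y ∈ s, ∃ z ∈ u, y < z := fun y hy => by
        have := hs y hy
        push Not at this
        obtain ⟨z, hz, hyz⟩ := this
        exact ⟨z, hz, hyz.lt_of_ne (hne z hz y (by simp [hy])).symm⟩
      have hsx : ∀ y ∈ s, y < x := fun y hy =>
        (hs' y hy).elim fun z h => h.2.trans (hx z h.1)
      have hmove := equivalent_move_max (a := m) (v := x :: t)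
        (fun y hy => (hs' y hy).imp fun z h => ⟨h.1, h.2, hu z h.1⟩)
        (fun y hy => ⟨x, by simp, (hsx y hy).le, hv x (by simp)⟩)
      refine ⟨(u ++ s) ++ m :: x :: t, he.trans hmove, ?_⟩
      refine IsBaxterWord.insert_before (by simpa using hB) (fun y hy => ?_) (by simpa using hm)
      exact (List.mem_append.1 hy).elim (hx y) (hsx y)

/-- Let `x` and `x'` be the first and last letters of `s`, with larger letters `y` in `u` and `z` in
`v`, and let `M` be the maximum of `u ++ v`. If `M` is in `u`, then `M`, `x' m`, `z` form 3-14-2 in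
the second word; if it is in `v`, then `y`, `m x`, `M` form 2-41-3 in the first. -/
theorem IsBaxterWord.eq_nil_of_depth_eq {u s v : List α} {m : α}
    (h : IsBaxterWord (u ++ m :: (s ++ v))) (h' : IsBaxterWord (u ++ s ++ m :: v))
    (hm : ∀ x ∈ u ++ s ++ v, x < m) (hnd : (u ++ s ++ v).Nodup)
    (hl : ∀ x ∈ s, ∃ y ∈ u, x < y) (hr : ∀ x ∈ s, ∃ z ∈ v, x ≤ z) : s = [] := by
  by_contra hs
  obtain ⟨x, s', e⟩ := List.exists_cons_of_ne_nil hs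
  obtain ⟨t, x', e'⟩ := (List.eq_nil_or_concat s).resolve_left hs
  obtain ⟨y, hy, hxy⟩ := hl x (by simp [e])
  obtain ⟨z, hz, hxz⟩ := hr x' (by simp [e'])
  have hne : ∀ a ∈ u ++ s, ∀ b ∈ v, a ≠ b := fun a ha b hb =>
    (List.nodup_append.1 hnd).2.2 a ha b hb
  obtain ⟨M, hM, hmax⟩ : ∃ M ∈ u ++ v, ∀ a ∈ u ++ v, a ≤ M := by
    obtain ⟨p, M, q, e, hp, hq⟩ := exists_split_max (w := u ++ v)
      (List.ne_nil_of_mem (List.mem_append_left v hy))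
    rw [e]
    refine ⟨M, by simp, fun a ha => ?_⟩
    simp only [List.mem_append, List.mem_cons] at ha
    rcases ha with ha | rfl | ha
    exacts [hp a ha, le_rfl, (hq a ha).le]
  rcases List.mem_append.1 hM with hM | hM
  · refine (h' (u ++ t) x' m v (by simp [e']) M (by simp [hM]) z hz).2 ⟨?_, ?_, hm M (by simp [hM])⟩
    · exact hxz.lt_of_ne (hne x' (by simp [e']) z hz)
    · exact (hmax z (by simp [hz])).lt_of_ne (hne M (by simp [hM]) z hz).symm
  · refine (h u m x (s' ++ v) (by simp [e]) y hy M (by simp [hM])).1 ⟨hxy, ?_, hm M (by simp [hM])⟩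
    exact (hmax y (by simp [hy])).lt_of_ne (hne y (by simp [hy]) M hM)

theorem IsBaxterWord.eq_of_pSymbol_eq {w w' : List α} (h : IsBaxterWord w)
    (h' : IsBaxterWord w') (hw : w.Nodup) (e : pSymbol w = pSymbol w') : w = w' := by
  induction hn : w.length generalizing w w' with
  | zero =>
    have := length_eq_of_pSymbol_eq e
    rw [List.length_eq_zero_iff.1 hn, List.length_eq_zero_iff.1 (this.symm.trans hn)]
  | succ n ih =>
    have hn' := (length_eq_of_pSymbol_eq e).symm.trans hn
    have hw' := (equivalent_of_pSymbol_eq e).perm.nodup_iff.1 hw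
    obtain ⟨u, a, v, rfl, hu, hv⟩ := exists_split_max (List.ne_nil_of_length_eq_add_one hn)
    obtain ⟨u', a', v', rfl, hu', hv'⟩ := exists_split_max (List.ne_nil_of_length_eq_add_one hn')
    obtain ⟨rfl, e, hl, hr⟩ := pSymbol_append_cons_injective hu hv hu' hv' e
    have hm := lt_max_of_nodup hw fun x hx =>
      (List.mem_append.1 hx).elim (hu x) fun hx => (hv x hx).le
    have hm' := lt_max_of_nodup hw' fun x hx =>
      (List.mem_append.1 hx).elim (hu' x) fun hx => (hv' x hx).le
    have hnd := (List.nodup_cons.1 (List.perm_middle.nodup_iff.1 hw)).2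
    have hnd' := (List.nodup_cons.1 (List.perm_middle.nodup_iff.1 hw')).2
    have key := ih (h.of_insert_max hm) (h'.of_insert_max hm') hnd e
      (by simp at hn ⊢; omega)
    rcases List.append_eq_append_iff.1 key with ⟨s, rfl, rfl⟩ | ⟨s, rfl, rfl⟩
    · obtain rfl := h.eq_nil_of_depth_eq h' hm' hnd' (leftDepth_eq_append_iff.1 hl)
        (rightDepth_eq_append_iff.1 hr.symm)
      simp
    · obtain rfl := h'.eq_nil_of_depth_eq h hm hnd (leftDepth_eq_append_iff.1 hl.symm)
        (rightDepth_eq_append_iff.1 hr)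
      simp

end BaxterWords

/-! ### Permutations as words without repetition -/

section PermutationWords

variable {n : ℕ}

theorem nodup_permWord (σ : Equiv.Perm (Fin n)) : (permWord σ).Nodup :=
  List.nodup_ofFn.2 σ.injective

theorem length_permWord (σ : Equiv.Perm (Fin n)) : (permWord σ).length = n :=
  List.length_ofFn

theorem permWord_injective : Function.Injective (permWord (n := n)) := fun _ _ h =>
  Equiv.coe_fn_injective (List.ofFn_injective h)

theorem exists_permWord_eq {w : List (Fin n)} (hw : w.Nodup) (hn : w.length = n) :
    ∃ σ, permWord σ = w := by
  have hinj : Function.Injective fun i : Fin n => w.get (i.cast hn.symm) := fun i j h => by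
    simpa using (List.nodup_iff_injective_get.1 hw) h
  refine ⟨Equiv.ofBijective _ (Finite.injective_iff_bijective.1 hinj), ?_⟩
  refine List.ext_getElem (by simp [permWord, hn]) fun i h h' => ?_
  simp [permWord]

theorem isBaxter_iff (σ : Equiv.Perm (Fin n)) : IsBaxter σ ↔ IsBaxterWord (permWord σ) := by
  constructor
  · intro h p x y q e c hc b hb
    have hn : n = p.length + (q.length + 2) := by
      have := congrArg List.length e
      simpa [permWord] using this
    have hget : ∀ i (hi : i < n), (p ++ x :: y :: q)[i]? = some (σ ⟨i, hi⟩) := fun i hi => by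
      rw [← e]; simp [permWord, hi]
    obtain ⟨i, hi, rfl⟩ := List.mem_iff_getElem.1 hc
    obtain ⟨l, hl, rfl⟩ := List.mem_iff_getElem.1 hb
    have h1 := hget i (by omega)
    have h2 := hget p.length (by omega)
    have h3 := hget (p.length + 1) (by omega)
    have h4 := hget (p.length + 1 + (l + 1)) (by omega)
    rw [List.getElem?_append_left hi, List.getElem?_eq_getElem hi, Option.some_inj] at h1
    rw [List.getElem?_append_right le_rfl] at h2
    rw [List.getElem?_append_right (by omega)] at h3 h4
    rw [show p.length + 1 + (l + 1) - p.length = l + 1 + 1 by omega] at h4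
    simp [hl] at h2 h3 h4
    rw [h1, h2, h3, h4]
    exact h _ _ _ _ hi rfl (by simp [Fin.lt_def])
  · intro h i j k l hij hjk hkl
    obtain ⟨k, hk⟩ := k
    simp only at hjk
    subst hjk
    have hlen := length_permWord σ
    have hget : ∀ (t : Fin n) (ht : t < (permWord σ).length), (permWord σ)[(t : ℕ)] = σ t :=
      fun t ht => by simp [permWord]
    have := h ((permWord σ).take j) (σ j) (σ ⟨j + 1, hk⟩) ((permWord σ).drop (j + 2)) (by
      conv_lhs => rw [← List.take_append_drop j (permWord σ)]
      rw [List.drop_eq_getElem_cons (by omega), List.drop_eq_getElem_cons (by omega)]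
      simp [permWord]) (σ i) (by
        rw [List.mem_take_iff_getElem]
        exact ⟨i, by simp [hlen, hij], hget i (by omega)⟩) (σ l) (by
        rw [List.mem_drop_iff_getElem]
        rw [Fin.lt_def] at hkl
        simp only at hkl
        refine ⟨l - (j + 2), by omega, ?_⟩
        rw [← hget l (by omega)]
        congr 1
        omega)
    exact ⟨fun H => this.1 H, fun H => this.2 H⟩

end PermutationWords

/-! ### Shapes and labelings of trees -/

section Shapes

variable {α : Type*}

theorem numNodes_shape (T : BinaryTree α) : (shape T).numNodes = T.numNodes := by
  induction T <;> simp_all [shape, BinaryTree.map]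

theorem canopy_shape (T : BinaryTree α) : canopy (shape T) = canopy T := by
  have : ∀ o, leafOrientations o (shape T) = leafOrientations o T := by
    induction T <;> simp_all [shape, BinaryTree.map, leafOrientations]
  rw [canopy, canopy, this]

theorem isTwin_shape_iff {n : ℕ} {J : BinaryTree α × BinaryTree α} :
    IsTwin n (shape J.1, shape J.2) ↔ IsTwin n J := by
  simp only [IsTwin, numNodes_shape, canopy_shape]

/-- The sizes of the subtrees tell where the inorder list is to be cut. -/
theorem eq_of_shape_eq {T T' : BinaryTree α} (h : shape T = shape T')
    (h' : inorder T = inorder T') : T = T' := by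
  induction T generalizing T' with
  | nil => cases T' <;> simp_all [shape, BinaryTree.map]
  | node a l r ihl ihr =>
    cases T' with
    | nil => simp [shape, BinaryTree.map] at h
    | node b l' r' =>
      simp only [shape, BinaryTree.map, BinaryTree.node.injEq, true_and] at h
      have hlen : (inorder l).length = (inorder l').length := by
        rw [length_inorder, length_inorder, ← numNodes_shape, ← numNodes_shape l']
        exact congrArg _ h.1
      obtain ⟨h1, h2⟩ := List.append_inj h' hlen
      rw [List.cons.injEq] at h2
      rw [h2.1, ihl h.1 h1, ihr h.2 h2.2]

theorem exists_shape_inorder_eq (S : BinaryTree Unit) {l : List α} (hl : l.length = S.numNodes) :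
    ∃ T, shape T = S ∧ inorder T = l := by
  induction S generalizing l with
  | nil => exact ⟨.nil, rfl, (List.length_eq_zero_iff.1 hl).symm⟩
  | node a s t ihs iht =>
    simp only [BinaryTree.numNodes] at hl
    obtain ⟨T, hT, hT'⟩ := ihs (l := l.take s.numNodes) (by simp; omega)
    obtain ⟨T', hU, hU'⟩ := iht (l := l.drop (s.numNodes + 1)) (by simp; omega)
    refine ⟨.node (l[s.numNodes]'(by omega)) T T', ?_, ?_⟩
    · simp [shape, BinaryTree.map, ← hT, ← hU]
    · rw [inorder, hT', hU', ← List.drop_eq_getElem_cons, List.take_append_drop]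

variable [LinearOrder α]

theorem isBST_of_pairwise_lt {T : BinaryTree α} (h : (inorder T).Pairwise (· < ·)) :
    IsLeftBST T ∧ IsRightBST T := by
  induction T with
  | nil => exact ⟨trivial, trivial⟩
  | node b s t ihs iht =>
    simp only [inorder, List.pairwise_append, List.pairwise_cons] at h
    obtain ⟨hs, ⟨hb, ht⟩, hst⟩ := h
    have hsb : ∀ a ∈ inorder s, a < b := fun a ha => hst a ha b (by simp)
    exact ⟨⟨hsb, fun c hc => (hb c hc).le, (ihs hs).1, (iht ht).1⟩,
      ⟨fun a ha => (hsb a ha).le, hb, (ihs hs).2, (iht ht).2⟩⟩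

end Shapes

/-! ### The three statements of the theorem -/

section Bijections

theorem inorder_pSymbol_permWord {n : ℕ} (σ : Equiv.Perm (Fin n)) :
    inorder (pSymbol (permWord σ)).1 = List.finRange n := by
  have h := (pSymbol_mem_twinSearchTrees (permWord σ)).2.1
  rw [isLeftBST_iff] at h
  refine List.Perm.eq_of_pairwise' (r := (· ≤ ·))
    (h.pairwise_le_inorder (fun _ _ => le_of_lt) fun _ _ => le_of_not_gt)
    (List.pairwise_le_finRange n) ?_
  rw [pSymbol_eq]
  refine (inorder_searchTree_perm _).trans ?_
  rw [permWord, List.ofFn_eq_map]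
  exact σ.map_finRange_perm

theorem existsUnique_isBaxter {n : ℕ} (C : Quotient (permSetoid n)) :
    ∃! σ : Equiv.Perm (Fin n), Quotient.mk (permSetoid n) σ = C ∧ IsBaxter σ := by
  induction C using Quotient.inductionOn with | _ τ
  obtain ⟨w, hw, hB⟩ := exists_equivalent_isBaxterWord (nodup_permWord τ)
  obtain ⟨σ, rfl⟩ := exists_permWord_eq (hw.perm.nodup_iff.1 (nodup_permWord τ))
    (hw.perm.length_eq.symm.trans (length_permWord τ))
  refine ⟨σ, ⟨Quotient.sound hw.symm, (isBaxter_iff σ).2 hB⟩, fun ρ ⟨h, hρ⟩ => ?_⟩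
  have h' : Equivalent (permWord ρ) (permWord σ) :=
    Equivalent.trans (Quotient.exact (s := permSetoid n) h) hw
  exact permWord_injective
    (((isBaxter_iff ρ).1 hρ).eq_of_pSymbol_eq hB (nodup_permWord ρ) h'.pSymbol_eq)

theorem exists_bijective_twinTrees (n : ℕ) :
    ∃ Φ : Quotient (permSetoid n) → twinTrees n, Function.Bijective Φ ∧
      ∀ σ : Equiv.Perm (Fin n), (Φ (Quotient.mk (permSetoid n) σ)).1 =
        (shape (pSymbol (permWord σ)).1, shape (pSymbol (permWord σ)).2) := by
  have hmem : ∀ σ : Equiv.Perm (Fin n), (shape (pSymbol (permWord σ)).1,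
      shape (pSymbol (permWord σ)).2) ∈ twinTrees n := fun σ => by
    have := (pSymbol_mem_twinSearchTrees (permWord σ)).1
    rw [length_permWord] at this
    exact isTwin_shape_iff.2 this
  refine ⟨Quotient.lift (fun σ => ⟨_, hmem σ⟩) fun σ τ h => ?_, ⟨?_, ?_⟩, fun σ => rfl⟩
  · have h' : Equivalent (permWord σ) (permWord τ) := h
    simp only [h'.pSymbol_eq]
  · intro C D h
    induction C using Quotient.inductionOn with | _ σ
    induction D using Quotient.inductionOn with | _ τ
    have h' := congrArg Subtype.val h
    simp only [Quotient.lift_mk, Prod.mk.injEq] at h'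
    have e := (inorder_pSymbol_permWord σ).trans (inorder_pSymbol_permWord τ).symm
    refine Quotient.sound (equivalent_of_pSymbol_eq (Prod.ext (eq_of_shape_eq h'.1 e)
      (eq_of_shape_eq h'.2 ?_)))
    rw [← inorder_pSymbol, ← inorder_pSymbol, e]
  · rintro ⟨⟨S, S'⟩, hS⟩
    -- Both shapes are labeled increasingly in inorder; as the labels are distinct, both search tree
    -- conditions hold.
    obtain ⟨T, rfl, hT⟩ := exists_shape_inorder_eq S (l := List.finRange n) (by simp [hS.1])
    obtain ⟨T', rfl, hT'⟩ := exists_shape_inorder_eq S' (l := List.finRange n) (by simp [hS.2.1])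
    have hlt := List.pairwise_lt_finRange n
    obtain ⟨w, hn, hw⟩ := exists_pSymbol_eq (n := n) (J := (T, T'))
      ⟨isTwin_shape_iff.1 hS, (isBST_of_pairwise_lt (hT ▸ hlt)).1,
        (isBST_of_pairwise_lt (hT' ▸ hlt)).2, hT.trans hT'.symm⟩
    have hp : (List.finRange n).Perm w := by
      rw [← hT, show T = (pSymbol w).1 by rw [hw], pSymbol_eq]
      exact inorder_searchTree_perm w
    obtain ⟨σ, rfl⟩ := exists_permWord_eq (hp.nodup_iff.1 (List.nodup_finRange n)) hn
    exact ⟨Quotient.mk _ σ, Subtype.ext (by simp [hw])⟩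

theorem exists_bijective_twinSearchTrees (α : Type*) [LinearOrder α] (n : ℕ) :
    ∃ Ψ : Quotient (wordSetoid α n) → twinSearchTrees α n, Function.Bijective Ψ ∧
      ∀ u : Word α n, (Ψ (Quotient.mk (wordSetoid α n) u)).1 = pSymbol u.1 := by
  have hmem : ∀ u : Word α n, pSymbol u.1 ∈ twinSearchTrees α n := fun u => by
    have := pSymbol_mem_twinSearchTrees u.1
    rwa [u.2] at this
  refine ⟨Quotient.lift (fun u => ⟨_, hmem u⟩) fun u v h => Subtype.ext
    (Equivalent.pSymbol_eq h), ⟨?_, ?_⟩, fun u => rfl⟩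
  · intro C D h
    induction C using Quotient.inductionOn with | _ u
    induction D using Quotient.inductionOn with | _ v
    exact Quotient.sound (equivalent_of_pSymbol_eq (congrArg Subtype.val h))
  · rintro ⟨J, hJ⟩
    obtain ⟨w, hn, hw⟩ := exists_pSymbol_eq hJ
    exact ⟨Quotient.mk _ ⟨w, hn⟩, Subtype.ext hw⟩

end Bijections

end Baxter

theorem mainTheorem3 {α : Type*} [LinearOrder α] (n : ℕ) :
    -- every equivalence class of permutations of size `n` contains exactly one Baxter permutation
    (∀ C : Quotient (Baxter.permSetoid n),
      ∃! σ : Equiv.Perm (Fin n), Quotient.mk (Baxter.permSetoid n) σ = C ∧ Baxter.IsBaxter σ) ∧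
    -- the shape of the P-symbol is a bijection from these classes to pairs of twin binary trees
    (∃ Φ : Quotient (Baxter.permSetoid n) → Baxter.twinTrees n,
      Function.Bijective Φ ∧
      ∀ σ : Equiv.Perm (Fin n), (Φ (Quotient.mk (Baxter.permSetoid n) σ)).1 =
        (Baxter.shape (Baxter.pSymbol (Baxter.permWord σ)).1,
          Baxter.shape (Baxter.pSymbol (Baxter.permWord σ)).2)) ∧
    -- the P-symbol is a bijection from the classes of words to pairs of twin binary search trees
    (∃ Ψ : Quotient (Baxter.wordSetoid α n) → Baxter.twinSearchTrees α n,
      Function.Bijective Ψ ∧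
      ∀ u : Baxter.Word α n,
        (Ψ (Quotient.mk (Baxter.wordSetoid α n) u)).1 = Baxter.pSymbol u.1) :=
  ⟨Baxter.existsUnique_isBaxter, Baxter.exists_bijective_twinTrees n,
    Baxter.exists_bijective_twinSearchTrees α n⟩
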